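/- There is an absolute constant $C>0$ such that the following holds for all integers $m,k,T\ge 1$. Let $D_1,\dots,D_m$ be probability distributions on $[0,1]$ with means $\mu_1,\dots,\mu_m$ (the $m$ arms), and let the actions be all sets $A\subseteq\{1,\dots,m\}$ with $|A|\le k$, with linear reward $r(A,v)=\sum_{i\in A}v_i$ for $v\in\mathbb R^m$. In each round $t=1,2,\dots$ the player chooses an action $A_t$ and the environment draws outcomes $X_i^{(t)}\sim D_i$, $1\le i\le m$, independent of each other and of everything that happened before, the choice of $A_t$ included; the player observes $X_i^{(t)}$ for $i\in A_t$ (semi-bandit feedback). The player uses the algorithm CMOSS with parameter $\delta=\frac{m}{kT}$: it keeps for each arm $i$ the number $T_i$ of observations made so far (initially $0$) and their empirical mean $\hat\mu_i$ (initially $1$), sets $$\rho_i=\sqrt{\tfrac1{T_i}\ln^+\!\big(\tfrac{1}{\delta T_i}\big)}\quad(\rho_i=+\infty\text{ if }T_i=0),\qquad \bar\mu_i=\min\{\hat\mu_i+\rho_i,\,1\},\qquad \ln^+x=\ln\max\{1,x\},$$ and plays an action $A_t\in\arg\max_{|A|\le k} r(A,\bar\mu)$, with ties broken in any way, possibly at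 random, that does not use the outcomes of the current and future rounds. Then its expected regret satisfies $$\mathbb E\Big[\sum_{t=1}^T\Big(\max_{|A|\le k} r(A,\mu)-r(A_t,\mu)\Big)\Big]\le C\,\big(\max\{1,\log_2 k\}\big)^2\sqrt{kmT}.$$ In particular, for $k\ge 2$ the expected regret is at most $C(\log_2 k)^2\sqrt{kmT}$. -/

import Mathlib

open MeasureTheory ProbabilityTheory

namespace CMOSS

noncomputable section

/-- The linear reward of the action `A` for the vector `v` of arm values. -/
def reward {m : ℕ} (A : Finset (Fin m)) (v : Fin m → ℝ) : ℝ := ∑ i ∈ A, v i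

/-- The actions: all sets of at most `k` of the `m` arms. -/
def actions (m k : ℕ) : Finset (Finset (Fin m)) :=
  Finset.univ.filter fun A => A.card ≤ k

theorem actions_nonempty (m k : ℕ) : (actions m k).Nonempty :=
  ⟨∅, by simp [actions]⟩

/-- The vector of mean rewards of the arms with reward distributions `D`. -/
def armMean {m : ℕ} (D : Fin m → Measure ℝ) (i : Fin m) : ℝ := ∫ x, x ∂(D i)

/-- The largest expected reward of an action, that is, the reward of a best action. -/
def bestReward {m : ℕ} (k : ℕ) (D : Fin m → Measure ℝ) : ℝ :=
  (actions m k).sup' (actions_nonempty m k) fun A => reward A (armMean D)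

/-- What the algorithm stores: the number of observations of each arm and its empirical mean. -/
structure Memory (m : ℕ) where
  count : Fin m → ℕ
  mean : Fin m → ℝ

/-- Initially nothing has been observed and all empirical means are set to `1`. -/
def Memory.init (m : ℕ) : Memory m := ⟨fun _ => 0, fun _ => 1⟩

/-- The update after the action `A` when the outcomes are `x`; only the values `x i` with
`i ∈ A` are used (semi-bandit feedback). -/
def Memory.update {m : ℕ} (s : Memory m) (A : Finset (Fin m)) (x : Fin m → ℝ) : Memory m where
  count i := if i ∈ A then s.count i + 1 else s.count i
  mean i := if i ∈ A then s.mean i + (x i - s.mean i) / ((s.count i : ℝ) + 1) else s.mean i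

/-- `ln⁺ x = ln (max {1, x})`. -/
def lnPlus (x : ℝ) : ℝ := Real.log (max 1 x)

/-- The confidence radius after `n ≥ 1` observations. -/
def radius (δ : ℝ) (n : ℕ) : ℝ := √(1 / (n : ℝ) * lnPlus (1 / (δ * n)))

/-- The optimistic estimate `min {mean + radius, 1}` of the mean of arm `i`. The radius of an arm
that was never observed is `+∞`, so that the estimate is then `1`. -/
def Memory.ucb {m : ℕ} (δ : ℝ) (s : Memory m) (i : Fin m) : ℝ :=
  if s.count i = 0 then 1 else min (s.mean i + radius δ (s.count i)) 1

/-- The memory after `t` rounds, when the actions are `A 0, A 1, …` and the outcome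
vectors are `x 0, x 1, …`. -/
def memory {m : ℕ} (A : ℕ → Finset (Fin m)) (x : ℕ → Fin m → ℝ) : ℕ → Memory m
  | 0 => Memory.init m
  | t + 1 => (memory A x t).update (A t) (x t)

/-- The environment: `X t` is the vector of outcomes in round `t` (rounds are numbered
from `0`), and `ℱ t` contains all that has happened before round `t`. In each round the outcomes
of the arms are independent of each other (product law), have the distributions `D i`, and are
independent of the past. -/
structure IsEnvironment {m : ℕ} (D : Fin m → Measure ℝ) {Ω : Type*} [mΩ : MeasurableSpace Ω]
    (P : Measure Ω) (ℱ : Filtration ℕ mΩ) (X : ℕ → Ω → Fin m → ℝ) : Prop where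
  measurable : ∀ t, Measurable[ℱ (t + 1)] (X t)
  law : ∀ t, P.map (X t) = Measure.pi D
  indep_past : ∀ t, Indep (MeasurableSpace.comap (X t) inferInstance) (ℱ t) P

/-- The action process `A` is a run of the algorithm with parameter `δ`: in every round it plays
a maximizer, over all actions, of the reward for the optimistic estimates. Ties may
be broken arbitrarily, also at random, but without looking into the future. -/
structure IsRun {m : ℕ} (k : ℕ) (δ : ℝ) {Ω : Type*} [mΩ : MeasurableSpace Ω]
    (ℱ : Filtration ℕ mΩ) (X : ℕ → Ω → Fin m → ℝ) (A : ℕ → Ω → Finset (Fin m)) : Prop where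
  nonanticipating : ∀ t B, MeasurableSet[ℱ t] {ω | A t ω = B}
  mem_actions : ∀ t ω, A t ω ∈ actions m k
  isMax : ∀ t ω, ∀ B ∈ actions m k,
    reward B ((memory (fun s => A s ω) (fun s => X s ω) t).ucb δ) ≤
      reward (A t ω) ((memory (fun s => A s ω) (fun s => X s ω) t).ucb δ)

/-- The expected regret over the first `T` rounds. -/
def expectedRegret {m : ℕ} (k : ℕ) (D : Fin m → Measure ℝ) {Ω : Type*} [MeasurableSpace Ω]
    (P : Measure Ω) (A : ℕ → Ω → Finset (Fin m)) (T : ℕ) : ℝ :=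
  ∫ ω, ∑ t ∈ Finset.range T, (bestReward k D - reward (A t ω) (armMean D)) ∂P

end

end CMOSS

namespace CMOSS

open scoped ENNReal NNReal

/-! The argument is that of MOSS, applied arm by arm. Let `B` be a best action and `u` the vector of
optimistic estimates in some round. Since the played action maximizes the reward for `u`, the regret
of the round is at most the underestimation `μ - u` summed over `B` plus the overestimation `u - μ`
summed over the played set.

Underestimation: the worst deficit of an arm over all rounds, `radiusExcess`, has expectation at
most `12 * √δ` (`lintegral_radiusExcess_le`, by dyadic peeling over the number of observations). It
is paid by at most `k` arms in each of `T` rounds.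

Overestimation: each play of an arm raises its count, so the cost of an arm over the rounds is a sum
over counts. The first play costs at most `1`, the radii sum to at most `6 / √δ` (`sum_radius_le`),
and deviations above a threshold `ε` have total expectation at most `1 / (2 * ε)`
(`sum_lintegral_constExcess_le`); the threshold itself costs `k * T * ε`.

Both deviation bounds rest on Ville's inequality, which copes with counts that depend on the
history. With `ε = √δ` and `δ = m / (kT)` every term is of order `√(kmT)`. No logarithm arises; the
factor in the theorem enters only through being at least `1`. -/

/-! ### Noise observed at predictable times: Ville's inequality and a maximal Hoeffding bound -/

/-- Noise `Y t` that is revealed after round `t`, is independent of the past, and is sub-Gaussian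
with variance proxy `1 / 4`. -/
structure IsSubgaussianNoise {Ω : Type*} [mΩ : MeasurableSpace Ω] (P : Measure Ω)
    (ℱ : Filtration ℕ mΩ) (Y : ℕ → Ω → ℝ) : Prop where
  measurable : ∀ t, Measurable[ℱ (t + 1)] (Y t)
  indep : ∀ t, Indep (ℱ t) (MeasurableSpace.comap (Y t) inferInstance) P
  mgf_le : ∀ t (l : ℝ),
    ∫⁻ ω, ENNReal.ofReal (Real.exp (l * Y t ω - l ^ 2 / 8)) ∂P ≤ 1

/-- The number of rounds before `t` in which an observation is made. -/
noncomputable def obsCount {Ω : Type*} (E : ℕ → Set Ω) (t : ℕ) (ω : Ω) : ℕ :=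
  ∑ s ∈ Finset.range t, (E s).indicator 1 ω

/-- The sum of the observations made before round `t`. -/
noncomputable def obsSum {Ω : Type*} (E : ℕ → Set Ω) (Y : ℕ → Ω → ℝ) (t : ℕ) (ω : Ω) : ℝ :=
  ∑ s ∈ Finset.range t, (E s).indicator (Y s) ω

section Observation

variable {Ω : Type*} {E : ℕ → Set Ω} {Y : ℕ → Ω → ℝ}

theorem obsCount_succ_of_mem {t : ℕ} {ω : Ω} (h : ω ∈ E t) :
    obsCount E (t + 1) ω = obsCount E t ω + 1 := by
  simp [obsCount, Finset.sum_range_succ, h]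

theorem obsCount_succ_of_notMem {t : ℕ} {ω : Ω} (h : ω ∉ E t) :
    obsCount E (t + 1) ω = obsCount E t ω := by
  simp [obsCount, Finset.sum_range_succ, h]

theorem obsSum_succ_of_mem {t : ℕ} {ω : Ω} (h : ω ∈ E t) :
    obsSum E Y (t + 1) ω = obsSum E Y t ω + Y t ω := by
  simp [obsSum, Finset.sum_range_succ, h]

theorem obsSum_succ_of_notMem {t : ℕ} {ω : Ω} (h : ω ∉ E t) :
    obsSum E Y (t + 1) ω = obsSum E Y t ω := by
  simp [obsSum, Finset.sum_range_succ, h]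

theorem obsCount_le (t : ℕ) (ω : Ω) : obsCount E t ω ≤ t := by
  induction t with
  | zero => simp [obsCount]
  | succ t ih =>
    by_cases h : ω ∈ E t
    · rw [obsCount_succ_of_mem h]; omega
    · rw [obsCount_succ_of_notMem h]; omega

theorem obsCount_mono (ω : Ω) : Monotone fun t => obsCount E t ω := by
  refine monotone_nat_of_le_succ fun t => ?_
  by_cases h : ω ∈ E t
  · simp only [obsCount_succ_of_mem h]; omega
  · simp only [obsCount_succ_of_notMem h]; omega

/-- The count rises strictly at every observation. Hence a sum over the rounds in which an arm is
played can be reindexed by the count. -/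
theorem obsCount_injOn (ω : Ω) : Set.InjOn (fun t => obsCount E t ω) {t | ω ∈ E t} := by
  have key : ∀ s t, ω ∈ E s → s < t → obsCount E s ω < obsCount E t ω := fun s t hs hst =>
    calc obsCount E s ω < obsCount E (s + 1) ω := by rw [obsCount_succ_of_mem hs]; omega
      _ ≤ obsCount E t ω := obsCount_mono ω hst
  intro s hs t ht h
  rcases lt_trichotomy s t with hlt | heq | hgt
  · exact absurd h (key s t hs hlt).ne
  · exact heq
  · exact absurd h (key t s ht hgt).ne'

theorem obsSum_neg (t : ℕ) (ω : Ω) :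
    obsSum E (fun s ω => -Y s ω) t ω = -obsSum E Y t ω := by
  induction t with
  | zero => simp [obsSum]
  | succ t ih =>
    by_cases h : ω ∈ E t
    · rw [obsSum_succ_of_mem h, obsSum_succ_of_mem h, ih]; ring
    · rw [obsSum_succ_of_notMem h, obsSum_succ_of_notMem h, ih]

variable [mΩ : MeasurableSpace Ω] {P : Measure Ω} {ℱ : Filtration ℕ mΩ}

theorem measurable_obsCount (hE : ∀ t, MeasurableSet[ℱ t] (E t)) (t : ℕ) :
    Measurable[ℱ t] (obsCount E t) := by
  refine Finset.measurable_fun_sum _ fun s hs => ?_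
  have hs' : s ≤ t := (Finset.mem_range.1 hs).le
  exact Measurable.indicator (m := ℱ t) measurable_const (ℱ.mono hs' _ (hE s))

theorem measurable_obsSum (hE : ∀ t, MeasurableSet[ℱ t] (E t))
    (hY : ∀ t, Measurable[ℱ (t + 1)] (Y t)) (t : ℕ) :
    Measurable[ℱ t] (obsSum E Y t) := by
  refine Finset.measurable_fun_sum _ fun s hs => ?_
  have hs' : s < t := Finset.mem_range.1 hs
  exact Measurable.indicator (m := ℱ t) ((hY s).mono (ℱ.mono hs') le_rfl)
    (ℱ.mono hs'.le _ (hE s))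

theorem IsSubgaussianNoise.neg (h : IsSubgaussianNoise P ℱ Y) :
    IsSubgaussianNoise P ℱ fun t ω => -Y t ω where
  measurable t := Measurable.neg (m := ℱ (t + 1)) (h.measurable t)
  indep t := by
    refine indep_of_indep_of_le_right (h.indep t) ?_
    exact (Measurable.comp measurable_neg (comap_measurable (Y t))).comap_le
  mgf_le t l := by
    simpa using h.mgf_le t (-l)

/-- The exponential supermartingale of the observed noise. -/
noncomputable def expProcess (E : ℕ → Set Ω) (Y : ℕ → Ω → ℝ) (l : ℝ) (t : ℕ) (ω : Ω) : ℝ≥0∞ :=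
  ENNReal.ofReal (Real.exp (l * obsSum E Y t ω - l ^ 2 / 8 * obsCount E t ω))

theorem measurable_expProcess (hE : ∀ t, MeasurableSet[ℱ t] (E t))
    (hY : ∀ t, Measurable[ℱ (t + 1)] (Y t)) (l : ℝ) (t : ℕ) :
    Measurable[ℱ t] (expProcess E Y l t) := by
  have h1 := measurable_obsSum hE hY t
  have h2 : Measurable[ℱ t] fun ω => (obsCount E t ω : ℝ) :=
    (measurable_from_top (f := fun n : ℕ => (n : ℝ))).comp (measurable_obsCount hE t)
  refine ENNReal.measurable_ofReal.comp (Real.measurable_exp.comp ?_)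
  exact Measurable.sub (m := ℱ t) (Measurable.const_mul (m := ℱ t) h1 l)
    (Measurable.const_mul (m := ℱ t) h2 _)

/-- The supermartingale property, tested on events of the past. On `E t` the process gains a factor
that is independent of `ℱ t` and has mean at most `1`; off `E t` it does not change. -/
theorem setLIntegral_expProcess_succ_le (h : IsSubgaussianNoise P ℱ Y)
    (hE : ∀ t, MeasurableSet[ℱ t] (E t)) (l : ℝ) (t : ℕ) {B : Set Ω}
    (hB : MeasurableSet[ℱ t] B) :
    ∫⁻ ω in B, expProcess E Y l (t + 1) ω ∂P ≤ ∫⁻ ω in B, expProcess E Y l t ω ∂P := by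
  have hE' : MeasurableSet (E t) := ℱ.le t _ (hE t)
  have hB' : MeasurableSet B := ℱ.le t _ hB
  rw [← lintegral_inter_add_sdiff _ B hE', ← lintegral_inter_add_sdiff _ B hE']
  refine add_le_add ?_ (le_of_eq ?_)
  · have hW := measurable_expProcess hE h.measurable l t
    set g : Ω → ℝ≥0∞ := fun ω => ENNReal.ofReal (Real.exp (l * Y t ω - l ^ 2 / 8)) with hg
    have hgm : Measurable[MeasurableSpace.comap (Y t) inferInstance] g := by
      have : Measurable fun y : ℝ => ENNReal.ofReal (Real.exp (l * y - l ^ 2 / 8)) := by fun_prop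
      exact this.comp (comap_measurable (Y t))
    have hle : MeasurableSpace.comap (Y t) inferInstance ≤ mΩ :=
      ((h.measurable t).mono (ℱ.le _) le_rfl).comap_le
    have hf : Measurable[ℱ t] ((B ∩ E t).indicator (expProcess E Y l t)) :=
      Measurable.indicator (m := ℱ t) hW (MeasurableSet.inter (m := ℱ t) hB (hE t))
    calc ∫⁻ ω in B ∩ E t, expProcess E Y l (t + 1) ω ∂P
        = ∫⁻ ω in B ∩ E t, expProcess E Y l t ω * g ω ∂P := by
          refine setLIntegral_congr_fun (hB'.inter hE') fun ω hω => ?_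
          simp only [expProcess, hg]
          rw [obsSum_succ_of_mem hω.2, obsCount_succ_of_mem hω.2,
            ← ENNReal.ofReal_mul (Real.exp_pos _).le, ← Real.exp_add]
          congr 2
          push_cast
          ring
      _ = ∫⁻ ω, (B ∩ E t).indicator (expProcess E Y l t) ω * g ω ∂P := by
          rw [← lintegral_indicator (hB'.inter hE')]
          refine lintegral_congr fun ω => ?_
          by_cases hω : ω ∈ B ∩ E t
          · simp [hω]
          · simp [Set.indicator_of_notMem hω]
      _ = (∫⁻ ω, (B ∩ E t).indicator (expProcess E Y l t) ω ∂P) * ∫⁻ ω, g ω ∂P :=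
          lintegral_mul_eq_lintegral_mul_lintegral_of_independent_measurableSpace (ℱ.le t) hle
            (h.indep t) hf hgm
      _ ≤ (∫⁻ ω, (B ∩ E t).indicator (expProcess E Y l t) ω ∂P) * 1 := by
          gcongr
          exact h.mgf_le t l
      _ = ∫⁻ ω in B ∩ E t, expProcess E Y l t ω ∂P := by
          rw [mul_one, lintegral_indicator (hB'.inter hE')]
  · refine setLIntegral_congr_fun (hB'.diff hE') fun ω hω => ?_
    simp only [expProcess]
    rw [obsSum_succ_of_notMem hω.2, obsCount_succ_of_notMem hω.2]

/-- Ville's inequality for the exponential supermartingale. -/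
theorem measure_exists_le_exponent_le [IsProbabilityMeasure P] (h : IsSubgaussianNoise P ℱ Y)
    (hE : ∀ t, MeasurableSet[ℱ t] (E t)) (l c : ℝ) (T : ℕ) :
    P {ω | ∃ t < T, c ≤ l * obsSum E Y t ω - l ^ 2 / 8 * obsCount E t ω} ≤
      ENNReal.ofReal (Real.exp (-c)) := by
  set C : ℕ → Set Ω := fun T =>
    {ω | ∃ t < T, c ≤ l * obsSum E Y t ω - l ^ 2 / 8 * obsCount E t ω} with hC
  set q : ℝ≥0∞ := ENNReal.ofReal (Real.exp c) with hq
  have hcross : ∀ t, {ω | c ≤ l * obsSum E Y t ω - l ^ 2 / 8 * obsCount E t ω} =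
      {ω | q ≤ expProcess E Y l t ω} := by
    intro t
    ext ω
    simp only [Set.mem_ofPred_eq, hq, expProcess]
    rw [ENNReal.ofReal_le_ofReal_iff (Real.exp_pos _).le, Real.exp_le_exp]
  have hcm : ∀ t, MeasurableSet[ℱ t] {ω | q ≤ expProcess E Y l t ω} := fun t =>
    measurable_expProcess hE h.measurable l t measurableSet_Ici
  have hCsucc : ∀ t, C (t + 1) = C t ∪ {ω | q ≤ expProcess E Y l t ω} := by
    intro t
    rw [← hcross]
    ext ω
    simp only [hC, Set.mem_ofPred_eq, Set.mem_union, Nat.lt_succ_iff_lt_or_eq]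
    constructor
    · rintro ⟨s, hs | rfl, hle⟩
      · exact Or.inl ⟨s, hs, hle⟩
      · exact Or.inr hle
    · rintro (⟨s, hs, hle⟩ | hle)
      · exact ⟨s, Or.inl hs, hle⟩
      · exact ⟨t, Or.inr rfl, hle⟩
  have hCm : ∀ t, MeasurableSet[ℱ t] (C t) := by
    intro t
    induction t with
    | zero => simp [hC]
    | succ t ih =>
      rw [hCsucc]
      exact ℱ.mono t.le_succ _ (MeasurableSet.union (m := ℱ t) ih (hcm t))
  -- Optional stopping as an invariant: paths that have crossed are frozen at the level `q`, while
  -- the others still carry the process.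
  have key : ∀ t, q * P (C t) + ∫⁻ ω in (C t)ᶜ, expProcess E Y l t ω ∂P ≤ 1 := by
    intro t
    induction t with
    | zero => simp [hC, expProcess, obsSum, obsCount]
    | succ t ih =>
      have m1 : MeasurableSet (C t) := ℱ.le t _ (hCm t)
      have m2 : MeasurableSet {ω | q ≤ expProcess E Y l t ω} := ℱ.le t _ (hcm t)
      have hcompl : (C (t + 1))ᶜ = (C t)ᶜ \ {ω | q ≤ expProcess E Y l t ω} := by
        rw [hCsucc, Set.compl_union, Set.sdiff_eq]
      have hm : MeasurableSet[ℱ t] (C (t + 1))ᶜ := by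
        rw [hcompl]
        exact MeasurableSet.diff (m := ℱ t) (MeasurableSet.compl (m := ℱ t) (hCm t)) (hcm t)
      refine le_trans ?_ ih
      calc q * P (C (t + 1)) + ∫⁻ ω in (C (t + 1))ᶜ, expProcess E Y l (t + 1) ω ∂P
          ≤ q * P (C (t + 1)) + ∫⁻ ω in (C (t + 1))ᶜ, expProcess E Y l t ω ∂P := by
            refine add_le_add le_rfl ?_
            exact setLIntegral_expProcess_succ_le h hE l t hm
        _ ≤ (q * P (C t) + q * P ((C t)ᶜ ∩ {ω | q ≤ expProcess E Y l t ω})) +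
              ∫⁻ ω in (C (t + 1))ᶜ, expProcess E Y l t ω ∂P := by
            refine add_le_add ?_ le_rfl
            rw [← mul_add]
            gcongr
            refine le_trans (measure_mono ?_) (measure_union_le _ _)
            rw [hCsucc]
            intro ω hω
            by_cases hωC : ω ∈ C t
            · exact Or.inl hωC
            · exact Or.inr ⟨hωC, hω.resolve_left hωC⟩
        _ ≤ (q * P (C t) + ∫⁻ ω in (C t)ᶜ ∩ {ω | q ≤ expProcess E Y l t ω},
              expProcess E Y l t ω ∂P) + ∫⁻ ω in (C (t + 1))ᶜ, expProcess E Y l t ω ∂P := by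
            refine add_le_add (add_le_add le_rfl ?_) le_rfl
            rw [← setLIntegral_const]
            exact setLIntegral_mono' (m1.compl.inter m2) fun ω hω => hω.2
        _ = q * P (C t) + ∫⁻ ω in (C t)ᶜ, expProcess E Y l t ω ∂P := by
            rw [add_assoc, hcompl, lintegral_inter_add_sdiff _ _ m2]
  have h1 : q * P (C T) ≤ 1 := le_trans le_self_add (key T)
  have hq0 : q ≠ 0 := by simp [hq, Real.exp_pos]
  rw [Real.exp_neg, ENNReal.ofReal_inv_of_pos (Real.exp_pos c)]
  rw [mul_comm] at h1
  exact (ENNReal.le_inv_iff_mul_le).2 h1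

/-- The maximal form of Hoeffding's inequality for at most `b` observations. -/
theorem measure_exists_obsSum_ge_le [IsProbabilityMeasure P] (h : IsSubgaussianNoise P ℱ Y)
    (hE : ∀ t, MeasurableSet[ℱ t] (E t)) {b y : ℝ} (hb : 0 < b) (hy : 0 ≤ y) (T : ℕ) :
    P {ω | ∃ t < T, (obsCount E t ω : ℝ) ≤ b ∧ y ≤ obsSum E Y t ω} ≤
      ENNReal.ofReal (Real.exp (-(2 * y ^ 2 / b))) := by
  -- The slope `4 * y / b` maximizes `l * y - l ^ 2 / 8 * b`, and the maximum is `2 * y ^ 2 / b`.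
  refine le_trans (measure_mono ?_) (measure_exists_le_exponent_le h hE (4 * y / b) _ T)
  rintro ω ⟨t, ht, hN, hS⟩
  refine ⟨t, ht, ?_⟩
  have h1 : (4 * y / b) * y ≤ (4 * y / b) * obsSum E Y t ω := by gcongr
  have h2 : (4 * y / b) ^ 2 / 8 * obsCount E t ω ≤ (4 * y / b) ^ 2 / 8 * b := by gcongr
  have h3 : 2 * y ^ 2 / b = (4 * y / b) * y - (4 * y / b) ^ 2 / 8 * b := by
    field_simp
    ring
  linarith

end Observation

/-! ### Real inequalities: confidence radii, exponential and dyadic sums -/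

section RealBounds

theorem lnPlus_nonneg (x : ℝ) : 0 ≤ lnPlus x := Real.log_nonneg (le_max_left _ _)

theorem lnPlus_mono {x y : ℝ} (h : x ≤ y) : lnPlus x ≤ lnPlus y :=
  Real.log_le_log (lt_max_of_lt_left one_pos) (max_le_max le_rfl h)

theorem lnPlus_of_le_one {x : ℝ} (h : x ≤ 1) : lnPlus x = 0 := by simp [lnPlus, h]

theorem lnPlus_le_two_mul_sqrt (x : ℝ) : lnPlus x ≤ 2 * √x := by
  rcases le_total x 1 with h | h
  · rw [lnPlus_of_le_one h]; positivity
  · have hx : 0 < √x := Real.sqrt_pos.2 (by linarith)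
    have h1 : Real.log x = 2 * Real.log (√x) := by
      rw [Real.log_sqrt (by linarith)]; ring
    rw [lnPlus, max_eq_right h, h1]
    linarith [Real.log_le_sub_one_of_pos hx]

theorem exp_neg_lnPlus_one_div_le {y : ℝ} (hy : 0 < y) :
    Real.exp (-lnPlus (1 / y)) ≤ min 1 y := by
  have hpos : (0 : ℝ) < max 1 (1 / y) := lt_max_of_lt_left one_pos
  rw [lnPlus, Real.exp_neg, Real.exp_log hpos]
  refine le_min (inv_le_one_of_one_le₀ (le_max_left _ _)) ?_
  calc (max 1 (1 / y))⁻¹ ≤ (1 / y)⁻¹ := inv_anti₀ (by positivity) (le_max_right _ _)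
    _ = y := by simp

theorem radius_nonneg (δ : ℝ) (n : ℕ) : 0 ≤ radius δ n := Real.sqrt_nonneg _

theorem natCast_mul_radius (δ : ℝ) {n : ℕ} (hn : 0 < n) :
    (n : ℝ) * radius δ n = √(n * lnPlus (1 / (δ * n))) := by
  have hn' : (0 : ℝ) < n := by exact_mod_cast hn
  rw [radius, ← Real.sqrt_sq hn'.le, ← Real.sqrt_mul (by positivity), Real.sqrt_sq hn'.le]
  congr 1
  field_simp

/-- Bounding the logarithm by a square root leaves a multiple of `n ^ (-3/4)`, which can be summed
by telescoping fourth roots. -/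
theorem radius_le {δ : ℝ} (hδ : 0 < δ) {n : ℕ} (hn : 0 < n) :
    radius δ n ≤ √2 / √(√δ) * (1 / √(√n) ^ 3) := by
  have hn' : (0 : ℝ) < n := by exact_mod_cast hn
  rw [radius]
  refine Real.sqrt_le_iff.2 ⟨by positivity, ?_⟩
  have h1 := lnPlus_le_two_mul_sqrt (1 / (δ * n))
  have h2 : √(1 / (δ * n)) = 1 / (√δ * √n) := by
    rw [Real.sqrt_div (by norm_num), Real.sqrt_one, Real.sqrt_mul hδ.le]
  rw [h2] at h1
  set a := √δ with ha
  set b := √(n : ℝ) with hb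
  have hapos : 0 < a := Real.sqrt_pos.2 hδ
  have hbpos : 0 < b := Real.sqrt_pos.2 hn'
  have hb2 : (n : ℝ) = b ^ 2 := (Real.sq_sqrt hn'.le).symm
  have e : (√2 / √a * (1 / √b ^ 3)) ^ 2 = 1 / b ^ 2 * (2 * (1 / (a * b))) := by
    rw [mul_pow, div_pow, div_pow, Real.sq_sqrt hapos.le, Real.sq_sqrt (by norm_num),
      ← pow_mul, show 3 * 2 = 2 * 3 by norm_num, pow_mul, Real.sq_sqrt hbpos.le]
    field_simp
  rw [e, ← hb2]
  gcongr

/-- With `a`, `b` the fourth roots of `n + 1`, `n`, factor `1 = a ^ 4 - b ^ 4` and bound the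
cofactor of `a - b` by `4 * a ^ 3`. -/
theorem one_div_cube_le_sub {n : ℕ} :
    1 / √(√((n + 1 : ℕ) : ℝ)) ^ 3 ≤ 4 * (√(√((n + 1 : ℕ) : ℝ)) - √(√(n : ℝ))) := by
  have h4 : ∀ x : ℝ, 0 ≤ x → √(√x) ^ 4 = x := fun x hx => by
    rw [show 4 = 2 * 2 by norm_num, pow_mul, Real.sq_sqrt (Real.sqrt_nonneg _), Real.sq_sqrt hx]
  have ha4 := h4 ((n + 1 : ℕ) : ℝ) (by positivity)
  have hb4 := h4 (n : ℝ) (by positivity)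
  have hab : √(√(n : ℝ)) ≤ √(√((n + 1 : ℕ) : ℝ)) := by gcongr; simp
  have hapos : 0 < √(√((n + 1 : ℕ) : ℝ)) := by positivity
  have hbpos : 0 ≤ √(√(n : ℝ)) := by positivity
  set a := √(√((n + 1 : ℕ) : ℝ))
  set b := √(√(n : ℝ))
  rw [div_le_iff₀ (by positivity)]
  have hdiff : a ^ 4 - b ^ 4 = 1 := by rw [ha4, hb4]; push_cast; ring
  have h1 : a ^ 2 * b ≤ a ^ 3 := by nlinarith [sq_nonneg a]
  have h2 : a * b ^ 2 ≤ a ^ 2 * b := by nlinarith [mul_nonneg hapos.le hbpos]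
  have h3 : b ^ 3 ≤ a * b ^ 2 := by nlinarith [sq_nonneg b]
  have : (a - b) * (a ^ 3 + a ^ 2 * b + a * b ^ 2 + b ^ 3) ≤ (a - b) * (4 * a ^ 3) :=
    mul_le_mul_of_nonneg_left (by linarith) (sub_nonneg.2 hab)
  nlinarith

/-- The confidence radii are summable up to the order of `1 / √δ`. -/
theorem sum_radius_le {δ : ℝ} (hδ : 0 < δ) (T : ℕ) :
    ∑ n ∈ Finset.range T, radius δ (n + 1) ≤ 6 / √δ := by
  -- The minimum records that radii vanish beyond `1 / δ` observations, which makes the bound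
  -- uniform in `T`.
  have key : ∑ n ∈ Finset.range T, radius δ (n + 1) ≤
      √2 / √(√δ) * (4 * √(√(min (T : ℝ) (1 / δ)))) := by
    induction T with
    | zero => simp; positivity
    | succ T ih =>
      rw [Finset.sum_range_succ]
      by_cases h : ((T + 1 : ℕ) : ℝ) ≤ 1 / δ
      · have hT : (T : ℝ) ≤ 1 / δ := le_trans (by push_cast; linarith) h
        rw [min_eq_left hT] at ih
        rw [min_eq_left h]
        have h1 := radius_le hδ (Nat.succ_pos T)
        have h2 : √2 / √(√δ) * (1 / √(√((T + 1 : ℕ) : ℝ)) ^ 3) ≤ √2 / √(√δ) *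
            (4 * (√(√((T + 1 : ℕ) : ℝ)) - √(√(T : ℝ)))) := by
          gcongr
          exact one_div_cube_le_sub
        rw [Nat.succ_eq_add_one] at h1
        linarith
      · have h0 : radius δ (T + 1) = 0 := by
          rw [radius, lnPlus_of_le_one, mul_zero, Real.sqrt_zero]
          rw [not_le, div_lt_iff₀ hδ] at h
          rw [div_le_one (by positivity), mul_comm]
          exact h.le
        rw [h0, add_zero]
        refine ih.trans ?_
        gcongr
        omega
  refine key.trans ?_
  calc √2 / √(√δ) * (4 * √(√(min (T : ℝ) (1 / δ))))
      ≤ √2 / √(√δ) * (4 * √(√(1 / δ))) := by gcongr; exact min_le_right _ _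
    _ = 4 * √2 / √δ := by
        have hd : 0 < √δ := Real.sqrt_pos.2 hδ
        rw [Real.sqrt_div (by norm_num), Real.sqrt_one, Real.sqrt_div (by norm_num), Real.sqrt_one]
        conv_rhs => rw [← Real.mul_self_sqrt hd.le]
        field_simp
    _ ≤ 6 / √δ := by
        gcongr
        nlinarith [Real.sq_sqrt (show (0 : ℝ) ≤ 2 by norm_num), Real.sqrt_nonneg 2]

theorem geom_sum_le_one_div {r : ℝ} (h0 : 0 ≤ r) (h1 : r < 1) (n : ℕ) :
    ∑ i ∈ Finset.range n, r ^ i ≤ 1 / (1 - r) := by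
  rw [geom_sum_eq h1.ne, ← neg_div_neg_eq]
  have : 0 < 1 - r := by linarith
  rw [neg_sub, neg_sub]
  gcongr
  linarith [pow_nonneg h0 n]

theorem sum_exp_neg_mul_le {v : ℝ} (hv : 0 < v) (T : ℕ) :
    ∑ n ∈ Finset.range T, Real.exp (-(2 * ((n + 1 : ℕ) : ℝ) * v ^ 2)) ≤ 1 / (2 * v ^ 2) := by
  set r := Real.exp (-(2 * v ^ 2)) with hr
  have hv2 : 0 < 2 * v ^ 2 := by positivity
  have hr1 : r < 1 := by rw [hr, Real.exp_lt_one_iff]; linarith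
  have hr0 : 0 < r := Real.exp_pos _
  have h1 : ∀ n : ℕ, Real.exp (-(2 * ((n + 1 : ℕ) : ℝ) * v ^ 2)) = r * r ^ n := fun n => by
    rw [hr, ← Real.exp_nat_mul, ← Real.exp_add]
    congr 1
    push_cast
    ring
  simp_rw [h1, ← Finset.mul_sum]
  have h2 : r * (1 + 2 * v ^ 2) ≤ 1 := by
    have : 1 + 2 * v ^ 2 ≤ Real.exp (2 * v ^ 2) := by linarith [Real.add_one_le_exp (2 * v ^ 2)]
    calc r * (1 + 2 * v ^ 2) ≤ r * Real.exp (2 * v ^ 2) := by gcongr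
      _ = 1 := by rw [hr, ← Real.exp_add]; simp
  calc r * ∑ i ∈ Finset.range T, r ^ i ≤ r * (1 / (1 - r)) := by
        gcongr
        exact geom_sum_le_one_div hr0.le hr1 T
    _ ≤ 1 / (2 * v ^ 2) := by
        rw [mul_one_div, div_le_div_iff₀ (by linarith) hv2]
        nlinarith

theorem exists_pow_two_mul_mem_Icc {δ : ℝ} (hδ : 0 < δ) (hδ1 : δ ≤ 1) :
    ∃ J : ℕ, 1 ≤ δ * 2 ^ J ∧ δ * 2 ^ J ≤ 2 := by
  obtain ⟨n, hn, hn'⟩ := exists_nat_pow_near (one_le_inv₀ hδ |>.2 hδ1) one_lt_two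
  refine ⟨n + 1, ?_, ?_⟩
  · have := mul_le_mul_of_nonneg_left hn'.le hδ.le
    rwa [mul_inv_cancel₀ hδ.ne'] at this
  · have := mul_le_mul_of_nonneg_left hn hδ.le
    rw [mul_inv_cancel₀ hδ.ne'] at this
    rw [pow_succ]
    linarith

/-- The terms rise geometrically until `2 ^ j` is about `1 / δ` and then fall geometrically. Cutting
at that index `J` and using one side of the minimum on each part makes both parts of order `√δ`. -/
theorem sum_min_div_sqrt_le {δ : ℝ} (hδ : 0 < δ) (hδ1 : δ ≤ 1) (T : ℕ) :
    ∑ j ∈ Finset.range T, min 1 (δ * 2 ^ (j + 1)) / √(2 ^ j) ≤ 12 * √δ := by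
  obtain ⟨J, hJ1, hJ2⟩ := exists_pow_two_mul_mem_Icc hδ hδ1
  set q := √2 with hq
  have hq2 : q ^ 2 = 2 := Real.sq_sqrt (by norm_num)
  have hqpos : 0 < q := by positivity
  have hq1 : 1.4 < q := by rw [hq]; exact Real.lt_sqrt_of_sq_lt (by norm_num)
  have hq15 : q < 1.42 := by rw [hq, Real.sqrt_lt' (by norm_num)]; norm_num
  have hsqrt : ∀ j : ℕ, √((2 : ℝ) ^ j) = q ^ j := fun j => by
    rw [← hq2, ← pow_mul, mul_comm, pow_mul, Real.sqrt_sq (by positivity)]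
  simp_rw [hsqrt]
  have hd : 0 < √δ := Real.sqrt_pos.2 hδ
  have hd2 : √δ ^ 2 = δ := Real.sq_sqrt hδ.le
  have hp : δ * 2 ^ J = (√δ * q ^ J) ^ 2 := by
    rw [mul_pow, hd2, ← pow_mul, mul_comm J, pow_mul, hq2]
  have hlow : 1 ≤ √δ * q ^ J := by
    rw [hp] at hJ1
    exact (one_le_sq_iff₀ (by positivity)).1 hJ1
  have hhigh : √δ * q ^ J ≤ q := by
    rw [hp, ← hq2] at hJ2
    exact (pow_le_pow_iff_left₀ (by positivity) hqpos.le two_ne_zero).1 hJ2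
  have hnn : ∀ j : ℕ, 0 ≤ min 1 (δ * 2 ^ (j + 1)) / q ^ j := fun j => by positivity
  calc ∑ j ∈ Finset.range T, min 1 (δ * 2 ^ (j + 1)) / q ^ j
      ≤ ∑ j ∈ Finset.range (J + T), min 1 (δ * 2 ^ (j + 1)) / q ^ j :=
        Finset.sum_le_sum_of_subset_of_nonneg (Finset.range_mono (by omega)) fun j _ _ => hnn j
    _ = ∑ j ∈ Finset.range J, min 1 (δ * 2 ^ (j + 1)) / q ^ j +
        ∑ i ∈ Finset.range T, min 1 (δ * 2 ^ (J + i + 1)) / q ^ (J + i) :=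
        Finset.sum_range_add _ _ _
    _ ≤ ∑ j ∈ Finset.range J, 2 * δ * q ^ j + ∑ i ∈ Finset.range T, (q ^ J)⁻¹ * (q⁻¹) ^ i := by
        gcongr with j _ i _
        · rw [div_le_iff₀ (by positivity)]
          calc min 1 (δ * 2 ^ (j + 1)) ≤ δ * 2 ^ (j + 1) := min_le_right _ _
            _ = 2 * δ * q ^ j * q ^ j := by
              rw [mul_assoc, ← pow_add, ← two_mul, pow_mul, hq2]; ring
        · calc min 1 (δ * 2 ^ (J + i + 1)) / q ^ (J + i) ≤ 1 / q ^ (J + i) := by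
                gcongr; exact min_le_left _ _
            _ = (q ^ J)⁻¹ * (q⁻¹) ^ i := by rw [pow_add, inv_pow]; field_simp
    _ ≤ 2 * δ * (q ^ J * (1 + q)) + (q ^ J)⁻¹ * (2 + q) := by
        rw [← Finset.mul_sum, ← Finset.mul_sum]
        gcongr
        · rw [geom_sum_eq (by linarith), div_le_iff₀ (by linarith)]
          nlinarith [pow_pos hqpos J]
        · refine (geom_sum_le_one_div (by positivity) (inv_lt_one_of_one_lt₀ (by linarith)) T).trans ?_
          have h1 : 1 - q⁻¹ = (q - 1) / q := by field_simp
          rw [h1, one_div_div, div_le_iff₀ (by linarith)]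
          nlinarith
    _ ≤ 2 * (√δ * q) * (1 + q) + √δ * (2 + q) := by
        have h1 : (q ^ J)⁻¹ ≤ √δ := by
          rw [inv_le_iff_one_le_mul₀ (by positivity)]
          exact hlow
        have h2 : δ * q ^ J ≤ √δ * q := by
          calc δ * q ^ J = √δ * (√δ * q ^ J) := by rw [← mul_assoc, ← sq, hd2]
            _ ≤ √δ * q := by gcongr
        have h3 : (q ^ J)⁻¹ * (2 + q) ≤ √δ * (2 + q) := by gcongr
        have h4 : δ * q ^ J * (2 * (1 + q)) ≤ √δ * q * (2 * (1 + q)) := by gcongr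
        linarith
    _ ≤ 12 * √δ := by
        have : 2 * q * (1 + q) + (2 + q) ≤ 12 := by nlinarith
        nlinarith

end RealBounds

/-! ### Expected maxima by integrating tail probabilities -/

section LayerCake

theorem setLIntegral_Ioi_gaussian {a b : ℝ} (ha : 0 ≤ a) (hb : 0 < b) :
    ∫⁻ x in Set.Ioi (0 : ℝ), ENNReal.ofReal (a * Real.exp (-(b * x ^ 2))) ≤
      ENNReal.ofReal (a / √b) := by
  have hint : Integrable (fun x : ℝ => a * Real.exp (-b * x ^ 2)) :=
    (integrable_exp_neg_mul_sq hb).const_mul a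
  simp_rw [← neg_mul]
  rw [← ofReal_integral_eq_lintegral_ofReal hint.integrableOn
    (Filter.Eventually.of_forall fun x => by positivity), integral_const_mul,
    integral_gaussian_Ioi]
  refine ENNReal.ofReal_le_ofReal ?_
  have hπ : √Real.pi ≤ 2 := (Real.sqrt_le_left (by norm_num)).2 (by linarith [Real.pi_le_four])
  have hb' : 0 < √b := Real.sqrt_pos.2 hb
  rw [Real.sqrt_div Real.pi_pos.le, div_eq_mul_one_div a]
  refine mul_le_mul_of_nonneg_left ?_ ha
  rw [div_div, div_le_div_iff₀ (by positivity) hb']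
  nlinarith

theorem setLIntegral_Ioi_inv_sq {ε : ℝ} (hε : 0 < ε) :
    ∫⁻ x in Set.Ioi (0 : ℝ), ENNReal.ofReal (1 / (2 * (x + ε) ^ 2)) ≤
      ENNReal.ofReal (1 / (2 * ε)) := by
  have hderiv : ∀ x ∈ Set.Ici (0 : ℝ),
      HasDerivAt (fun x : ℝ => -(2 * (x + ε))⁻¹) (1 / (2 * (x + ε) ^ 2)) x := by
    intro x hx
    have hx' : 0 < x + ε := by linarith [Set.mem_Ici.1 hx]
    have h1 : HasDerivAt (fun x : ℝ => 2 * (x + ε)) 2 x := by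
      simpa using ((hasDerivAt_id x).add_const ε).const_mul 2
    refine (h1.inv (by positivity)).neg.congr_deriv ?_
    rw [mul_pow, neg_div, neg_neg, div_eq_div_iff (by positivity) (by positivity)]
    ring
  have htend : Filter.Tendsto (fun x : ℝ => -(2 * (x + ε))⁻¹) Filter.atTop (nhds 0) := by
    rw [← neg_zero]
    refine (Filter.Tendsto.inv_tendsto_atTop ?_).neg
    exact (Filter.tendsto_atTop_add_const_right _ ε Filter.tendsto_id).const_mul_atTop two_pos
  have hpos : ∀ x ∈ Set.Ioi (0 : ℝ), (0 : ℝ) ≤ 1 / (2 * (x + ε) ^ 2) := fun x _ => by positivity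
  have hint := integrableOn_Ioi_deriv_of_nonneg' hderiv hpos htend
  rw [← ofReal_integral_eq_lintegral_ofReal hint
    (Filter.Eventually.of_forall fun x => by positivity),
    integral_Ioi_of_hasDerivAt_of_nonneg' hderiv hpos htend]
  simp

variable {Ω : Type*}

/-- The largest positive part of `z t` over the rounds `t < T` in which `Q t` holds. -/
noncomputable def supPosPart (T : ℕ) (Q : ℕ → Set Ω) (z : ℕ → Ω → ℝ) (ω : Ω) : ℝ≥0 :=
  (Finset.range T).sup fun t => (Q t).indicator (fun ω => (z t ω).toNNReal) ω

theorem le_supPosPart {T t : ℕ} (ht : t < T) {Q : ℕ → Set Ω} {z : ℕ → Ω → ℝ} {ω : Ω}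
    (hQ : ω ∈ Q t) : z t ω ≤ supPosPart T Q z ω := by
  refine (Real.le_coe_toNNReal _).trans (NNReal.coe_le_coe.2 ?_)
  have := Finset.le_sup (f := fun t => (Q t).indicator (fun ω => (z t ω).toNNReal) ω)
    (Finset.mem_range.2 ht)
  rw [Set.indicator_of_mem hQ] at this
  exact this

theorem lt_supPosPart_iff {T : ℕ} {Q : ℕ → Set Ω} {z : ℕ → Ω → ℝ} {ω : Ω} {x : ℝ} (hx : 0 < x) :
    x < supPosPart T Q z ω ↔ ∃ t < T, ω ∈ Q t ∧ x < z t ω := by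
  lift x to ℝ≥0 using hx.le
  rw [NNReal.coe_lt_coe, supPosPart, Finset.lt_sup_iff]
  refine exists_congr fun t => ?_
  rw [Finset.mem_range]
  refine and_congr_right fun _ => ?_
  by_cases h : ω ∈ Q t
  · simp [h, Real.lt_toNNReal_iff_coe_lt]
  · simp [h]

theorem measurable_supPosPart [MeasurableSpace Ω] {T : ℕ} {Q : ℕ → Set Ω} {z : ℕ → Ω → ℝ}
    (hQ : ∀ t, MeasurableSet (Q t)) (hz : ∀ t, Measurable (z t)) :
    Measurable (supPosPart T Q z) := by
  have : supPosPart T Q z =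
      (Finset.range T).sup fun t => (Q t).indicator fun ω => (z t ω).toNNReal := by
    ext ω
    simp [supPosPart, Finset.sup_apply]
  rw [this]
  refine Finset.sup_induction measurable_const (fun _ hf _ hg => hf.sup hg) fun t _ => ?_
  exact (hz t).real_toNNReal.indicator (hQ t)

theorem lintegral_supPosPart_le [MeasurableSpace Ω] (P : Measure Ω) {T : ℕ} {Q : ℕ → Set Ω}
    {z : ℕ → Ω → ℝ} (hQ : ∀ t, MeasurableSet (Q t)) (hz : ∀ t, Measurable (z t))
    {h : ℝ → ℝ≥0∞} (hh : ∀ x, 0 < x → P {ω | ∃ t < T, ω ∈ Q t ∧ x < z t ω} ≤ h x) :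
    ∫⁻ ω, supPosPart T Q z ω ∂P ≤ ∫⁻ x in Set.Ioi (0 : ℝ), h x := by
  have h1 := lintegral_eq_lintegral_meas_lt P (f := fun ω => (supPosPart T Q z ω : ℝ))
    (Filter.Eventually.of_forall fun ω => NNReal.coe_nonneg _)
    (measurable_supPosPart hQ hz).coe_nnreal_real.aemeasurable
  simp only [ENNReal.ofReal_coe_nnreal] at h1
  rw [h1]
  refine setLIntegral_mono' measurableSet_Ioi fun x hx => ?_
  simp_rw [lt_supPosPart_iff (Set.mem_Ioi.1 hx)]
  exact hh x hx

end LayerCake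

/-! ### Expected deviations beyond the radius and beyond a constant threshold -/

section Deviation

variable {Ω : Type*}

/-- The largest amount by which an average of the observed noise exceeds the confidence radius. -/
noncomputable def radiusExcess (δ : ℝ) (E : ℕ → Set Ω) (Y : ℕ → Ω → ℝ) (T : ℕ) : Ω → ℝ≥0 :=
  supPosPart T (fun t => {ω | 0 < obsCount E t ω}) fun t ω =>
    obsSum E Y t ω / obsCount E t ω - radius δ (obsCount E t ω)

/-- The amount by which the average of the first `n` noise observations exceeds `ε`. -/
noncomputable def constExcess (ε : ℝ) (E : ℕ → Set Ω) (Y : ℕ → Ω → ℝ) (T n : ℕ) : Ω → ℝ≥0 :=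
  supPosPart T (fun t => {ω | obsCount E t ω = n}) fun t ω =>
    obsSum E Y t ω / obsCount E t ω - ε

variable {E : ℕ → Set Ω} {Y : ℕ → Ω → ℝ} [mΩ : MeasurableSpace Ω] {P : Measure Ω}
  {ℱ : Filtration ℕ mΩ}

theorem measurable_obsAverage (hE : ∀ t, MeasurableSet[ℱ t] (E t))
    (hY : ∀ t, Measurable[ℱ (t + 1)] (Y t)) (t : ℕ) :
    Measurable fun ω => obsSum E Y t ω / obsCount E t ω := by
  have h1 : Measurable (obsSum E Y t) := (measurable_obsSum hE hY t).mono (ℱ.le t) le_rfl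
  have h2 : Measurable (obsCount E t) := (measurable_obsCount hE t).mono (ℱ.le t) le_rfl
  exact h1.div ((measurable_from_top (f := fun n : ℕ => (n : ℝ))).comp h2)

theorem measurableSet_obsCount (hE : ∀ t, MeasurableSet[ℱ t] (E t)) (t : ℕ) (s : Set ℕ) :
    MeasurableSet {ω | obsCount E t ω ∈ s} :=
  (measurable_obsCount hE t).mono (ℱ.le t) le_rfl (MeasurableSet.of_discrete (s := s))

theorem measurable_radiusExcess (hE : ∀ t, MeasurableSet[ℱ t] (E t))
    (hY : ∀ t, Measurable[ℱ (t + 1)] (Y t)) (δ : ℝ) (T : ℕ) :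
    Measurable (radiusExcess δ E Y T) :=
  measurable_supPosPart (fun t => measurableSet_obsCount hE t {n | 0 < n}) fun t =>
    (measurable_obsAverage hE hY t).sub ((measurable_from_top (f := fun n : ℕ => radius δ n)).comp
      ((measurable_obsCount hE t).mono (ℱ.le t) le_rfl))

theorem measurable_constExcess (hE : ∀ t, MeasurableSet[ℱ t] (E t))
    (hY : ∀ t, Measurable[ℱ (t + 1)] (Y t)) (ε : ℝ) (T n : ℕ) :
    Measurable (constExcess ε E Y T n) :=
  measurable_supPosPart (fun t => measurableSet_obsCount hE t {n}) fun t =>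
    (measurable_obsAverage hE hY t).sub_const ε

/-- Peeling: if the count `N` lies in `[2 ^ j, 2 ^ (j + 1))`, an excess `x` forces the sum of
observations above `y j`, a level that depends on `j` alone. The maximal Hoeffding inequality with
`b = 2 ^ (j + 1)` then treats the whole block at once. -/
theorem measure_radiusExcess_gt_le [IsProbabilityMeasure P] (h : IsSubgaussianNoise P ℱ Y)
    (hE : ∀ t, MeasurableSet[ℱ t] (E t)) {δ : ℝ} (hδ : 0 < δ) (T : ℕ) {x : ℝ} (hx : 0 < x) :
    P {ω | ∃ t < T, ω ∈ {ω | 0 < obsCount E t ω} ∧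
        x < obsSum E Y t ω / obsCount E t ω - radius δ (obsCount E t ω)} ≤
      ∑ j ∈ Finset.range T,
        ENNReal.ofReal (min 1 (δ * 2 ^ (j + 1)) * Real.exp (-(2 ^ j * x ^ 2))) := by
  set y : ℕ → ℝ := fun j => √(2 ^ j * lnPlus (1 / (δ * 2 ^ (j + 1)))) + 2 ^ j * x with hy
  have hy0 : ∀ j, 0 ≤ y j := fun j => by positivity
  calc _ ≤ P (⋃ j ∈ Finset.range T,
        {ω | ∃ t < T, (obsCount E t ω : ℝ) ≤ 2 ^ (j + 1) ∧ y j ≤ obsSum E Y t ω}) := by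
        refine measure_mono ?_
        rintro ω ⟨t, ht, hN, hz⟩
        have hN0 : 0 < obsCount E t ω := hN
        have hNt : obsCount E t ω ≤ t := obsCount_le t ω
        set N := obsCount E t ω with hNdef
        have hlow : 2 ^ Nat.log 2 N ≤ N := Nat.pow_log_le_self 2 hN0.ne'
        have hhigh : N < 2 ^ (Nat.log 2 N + 1) := Nat.lt_pow_succ_log_self one_lt_two N
        have hj : Nat.log 2 N ≤ N := Nat.log_le_self 2 N
        set j := Nat.log 2 N
        have hlow' : (2 : ℝ) ^ j ≤ N := by exact_mod_cast hlow
        have hhigh' : (N : ℝ) ≤ 2 ^ (j + 1) := by exact_mod_cast hhigh.le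
        have hNpos : (0 : ℝ) < N := by exact_mod_cast hN0
        simp only [Set.mem_iUnion]
        refine ⟨j, Finset.mem_range.2 (by omega), t, ht, hhigh', ?_⟩
        rw [lt_sub_iff_add_lt, lt_div_iff₀ hNpos] at hz
        have h1 : √(2 ^ j * lnPlus (1 / (δ * 2 ^ (j + 1)))) ≤ N * radius δ N := by
          rw [natCast_mul_radius δ hN0]
          refine Real.sqrt_le_sqrt ?_
          refine mul_le_mul hlow' (lnPlus_mono ?_) (lnPlus_nonneg _) hNpos.le
          gcongr
        have h2 : 2 ^ j * x ≤ N * x := by gcongr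
        simp only [hy]
        linarith
    _ ≤ ∑ j ∈ Finset.range T,
        P {ω | ∃ t < T, (obsCount E t ω : ℝ) ≤ 2 ^ (j + 1) ∧ y j ≤ obsSum E Y t ω} :=
        measure_biUnion_finset_le _ _
    _ ≤ _ := by
        refine Finset.sum_le_sum fun j _ => ?_
        refine (measure_exists_obsSum_ge_le h hE (by positivity) (hy0 j) T).trans ?_
        refine ENNReal.ofReal_le_ofReal ?_
        set L := lnPlus (1 / (δ * 2 ^ (j + 1))) with hL
        have hL0 : 0 ≤ L := lnPlus_nonneg _
        calc Real.exp (-(2 * y j ^ 2 / 2 ^ (j + 1))) ≤ Real.exp (-L + -(2 ^ j * x ^ 2)) := by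
              -- Squaring `y j` and dropping the nonnegative cross term separates the radius, which
              -- yields the factor `min 1 (δ * 2 ^ (j + 1))`, from the Gaussian tail in `x`.
              rw [Real.exp_le_exp, ← neg_add, neg_le_neg_iff, le_div_iff₀ (by positivity)]
              have hs : √(2 ^ j * L) ^ 2 = 2 ^ j * L := Real.sq_sqrt (by positivity)
              have hc : 0 ≤ √(2 ^ j * L) * (2 ^ j * x) := by positivity
              have : y j ^ 2 = √(2 ^ j * L) ^ 2 + 2 * (√(2 ^ j * L) * (2 ^ j * x)) +
                  (2 ^ j * x) ^ 2 := by simp only [hy]; ring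
              rw [this, hs, pow_succ (2 : ℝ) j]
              nlinarith
          _ ≤ min 1 (δ * 2 ^ (j + 1)) * Real.exp (-(2 ^ j * x ^ 2)) := by
              rw [Real.exp_add]
              gcongr
              exact exp_neg_lnPlus_one_div_le (by positivity)

theorem lintegral_radiusExcess_le [IsProbabilityMeasure P] (h : IsSubgaussianNoise P ℱ Y)
    (hE : ∀ t, MeasurableSet[ℱ t] (E t)) {δ : ℝ} (hδ : 0 < δ) (hδ1 : δ ≤ 1) (T : ℕ) :
    ∫⁻ ω, radiusExcess δ E Y T ω ∂P ≤ ENNReal.ofReal (12 * √δ) := by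
  refine (lintegral_supPosPart_le P (fun t => measurableSet_obsCount hE t {n | 0 < n}) (fun t =>
    (measurable_obsAverage hE h.measurable t).sub
      ((measurable_from_top (f := fun n : ℕ => radius δ n)).comp
        ((measurable_obsCount hE t).mono (ℱ.le t) le_rfl))) fun x hx =>
    measure_radiusExcess_gt_le h hE hδ T hx).trans ?_
  rw [lintegral_finsetSum _ fun j _ => by fun_prop]
  calc _ ≤ ∑ j ∈ Finset.range T, ENNReal.ofReal (min 1 (δ * 2 ^ (j + 1)) / √(2 ^ j)) :=
        Finset.sum_le_sum fun j _ => setLIntegral_Ioi_gaussian (by positivity) (by positivity)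
    _ = ENNReal.ofReal (∑ j ∈ Finset.range T, min 1 (δ * 2 ^ (j + 1)) / √(2 ^ j)) :=
        (ENNReal.ofReal_sum_of_nonneg fun j _ => by positivity).symm
    _ ≤ _ := ENNReal.ofReal_le_ofReal (sum_min_div_sqrt_le hδ hδ1 T)

theorem measure_constExcess_gt_le [IsProbabilityMeasure P] (h : IsSubgaussianNoise P ℱ Y)
    (hE : ∀ t, MeasurableSet[ℱ t] (E t)) {ε : ℝ} (hε : 0 < ε) (T n : ℕ) {x : ℝ} (hx : 0 < x) :
    P {ω | ∃ t < T, ω ∈ {ω | obsCount E t ω = n + 1} ∧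
        x < obsSum E Y t ω / obsCount E t ω - ε} ≤
      ENNReal.ofReal (Real.exp (-(2 * ((n + 1 : ℕ) : ℝ) * (x + ε) ^ 2))) := by
  have hn : (0 : ℝ) < ((n + 1 : ℕ) : ℝ) := by positivity
  refine le_trans (measure_mono ?_) ((measure_exists_obsSum_ge_le h hE hn
    (y := ((n + 1 : ℕ) : ℝ) * (x + ε)) (by positivity) T).trans_eq ?_)
  · rintro ω ⟨t, ht, hN, hz⟩
    have hN' : obsCount E t ω = n + 1 := hN
    rw [hN', lt_sub_iff_add_lt, lt_div_iff₀ hn] at hz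
    refine ⟨t, ht, by rw [hN'], ?_⟩
    rw [mul_comm]
    exact hz.le
  · congr 3
    field_simp

theorem sum_lintegral_constExcess_le [IsProbabilityMeasure P] (h : IsSubgaussianNoise P ℱ Y)
    (hE : ∀ t, MeasurableSet[ℱ t] (E t)) {ε : ℝ} (hε : 0 < ε) (T : ℕ) :
    ∑ n ∈ Finset.range T, ∫⁻ ω, constExcess ε E Y T (n + 1) ω ∂P ≤
      ENNReal.ofReal (1 / (2 * ε)) := by
  calc _ ≤ ∑ n ∈ Finset.range T, ∫⁻ x in Set.Ioi (0 : ℝ),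
        ENNReal.ofReal (Real.exp (-(2 * ((n + 1 : ℕ) : ℝ) * (x + ε) ^ 2))) :=
        Finset.sum_le_sum fun n _ =>
          lintegral_supPosPart_le P (fun t => measurableSet_obsCount hE t {n + 1}) (fun t =>
            (measurable_obsAverage hE h.measurable t).sub_const ε) fun x hx =>
            measure_constExcess_gt_le h hE hε T n hx
    -- Summing over the counts before integrating in `x` turns the tails into a geometric series.
    _ = ∫⁻ x in Set.Ioi (0 : ℝ), ∑ n ∈ Finset.range T,
        ENNReal.ofReal (Real.exp (-(2 * ((n + 1 : ℕ) : ℝ) * (x + ε) ^ 2))) :=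
        (lintegral_finsetSum _ fun n _ => by fun_prop).symm
    _ ≤ ∫⁻ x in Set.Ioi (0 : ℝ), ENNReal.ofReal (1 / (2 * (x + ε) ^ 2)) := by
        refine setLIntegral_mono' measurableSet_Ioi fun x hx => ?_
        rw [← ENNReal.ofReal_sum_of_nonneg fun n _ => (Real.exp_pos _).le]
        exact ENNReal.ofReal_le_ofReal (sum_exp_neg_mul_le (add_pos hx hε) T)
    _ ≤ _ := setLIntegral_Ioi_inv_sq hε

end Deviation

/-! ### Elementary bounds on means and rewards -/

section Arms

variable {m : ℕ} {D : Fin m → Measure ℝ}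

theorem ae_mem_Icc (hD : ∀ i, D i (Set.Icc (0 : ℝ) 1)ᶜ = 0) (i : Fin m) :
    ∀ᵐ x ∂(D i), x ∈ Set.Icc (0 : ℝ) 1 := hD i

theorem armMean_nonneg (hD : ∀ i, D i (Set.Icc (0 : ℝ) 1)ᶜ = 0) (i : Fin m) :
    0 ≤ armMean D i :=
  integral_nonneg_of_ae ((ae_mem_Icc hD i).mono fun _ hx => hx.1)

theorem reward_armMean_nonneg (hD : ∀ i, D i (Set.Icc (0 : ℝ) 1)ᶜ = 0) (A : Finset (Fin m)) :
    0 ≤ reward A (armMean D) :=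
  Finset.sum_nonneg fun i _ => armMean_nonneg hD i

variable [∀ i, IsProbabilityMeasure (D i)]

theorem armMean_le_one (hD : ∀ i, D i (Set.Icc (0 : ℝ) 1)ᶜ = 0) (i : Fin m) :
    armMean D i ≤ 1 := by
  have h := integral_mono_ae (μ := D i) (f := fun x => x) (g := fun _ => 1)
    (Integrable.of_mem_Icc 0 1 aemeasurable_id (ae_mem_Icc hD i)) (integrable_const _)
    ((ae_mem_Icc hD i).mono fun _ hx => hx.2)
  simpa [armMean] using h

theorem reward_armMean_le (hD : ∀ i, D i (Set.Icc (0 : ℝ) 1)ᶜ = 0) (A : Finset (Fin m)) :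
    reward A (armMean D) ≤ A.card := by
  simpa [reward] using Finset.sum_le_card_nsmul A (armMean D) 1 fun i _ => armMean_le_one hD i

theorem card_le_of_mem_actions {k : ℕ} {A : Finset (Fin m)} (hA : A ∈ actions m k) :
    A.card ≤ k := by simpa [actions] using hA

theorem bestReward_le (hD : ∀ i, D i (Set.Icc (0 : ℝ) 1)ᶜ = 0) (k : ℕ) :
    bestReward k D ≤ min (k : ℝ) m := by
  refine Finset.sup'_le _ _ fun A hA => (reward_armMean_le hD A).trans (le_min ?_ ?_)
  · exact_mod_cast card_le_of_mem_actions hA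
  · exact_mod_cast (Finset.card_le_univ A).trans_eq (Fintype.card_fin m)

theorem reward_le_bestReward {k : ℕ} (D : Fin m → Measure ℝ) {A : Finset (Fin m)}
    (hA : A ∈ actions m k) : reward A (armMean D) ≤ bestReward k D :=
  Finset.le_sup' (fun A => reward A (armMean D)) hA

end Arms

/-! ### Runs of the algorithm: regret decomposition and expectation -/

section Run

variable {m : ℕ} {D : Fin m → Measure ℝ} {Ω : Type*}
  {X : ℕ → Ω → Fin m → ℝ} {A : ℕ → Ω → Finset (Fin m)}

/-- The event that arm `i` is played in round `t`. -/
def played (A : ℕ → Ω → Finset (Fin m)) (i : Fin m) (t : ℕ) : Set Ω := {ω | i ∈ A t ω}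

/-- The deviation of the outcome of arm `i` in round `t` from its mean. -/
noncomputable def noise (D : Fin m → Measure ℝ) (X : ℕ → Ω → Fin m → ℝ) (i : Fin m) (t : ℕ)
    (ω : Ω) : ℝ :=
  X t ω i - armMean D i

theorem memory_count (t : ℕ) (ω : Ω) (i : Fin m) :
    (memory (fun s => A s ω) (fun s => X s ω) t).count i = obsCount (played A i) t ω := by
  induction t with
  | zero => simp [memory, Memory.init, obsCount]
  | succ t ih =>
    by_cases h : i ∈ A t ω
    · rw [obsCount_succ_of_mem h]
      simp [memory, Memory.update, h, ih]
    · rw [obsCount_succ_of_notMem h]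
      simp [memory, Memory.update, h, ih]

/-- Identifies the recursively updated mean with a true average. At count `0` both sides vanish, so
the initial value `1` plays no role. -/
theorem obsSum_noise_eq (D : Fin m → Measure ℝ) (t : ℕ) (ω : Ω) (i : Fin m) :
    obsSum (played A i) (noise D X i) t ω = obsCount (played A i) t ω *
      ((memory (fun s => A s ω) (fun s => X s ω) t).mean i - armMean D i) := by
  induction t with
  | zero => simp [obsCount, obsSum]
  | succ t ih =>
    by_cases h : i ∈ A t ω
    · rw [obsCount_succ_of_mem h, obsSum_succ_of_mem h, ih]
      simp only [memory, Memory.update, h, if_true, memory_count, noise]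
      push_cast
      field_simp
      ring
    · rw [obsCount_succ_of_notMem h, obsSum_succ_of_notMem h, ih]
      simp [memory, Memory.update, h]

/-- Neither the clipping at `1` nor the value `1` of an unobserved arm can cause underestimation,
since means are at most `1`. -/
theorem armMean_sub_ucb_le [∀ i, IsProbabilityMeasure (D i)]
    (hD : ∀ i, D i (Set.Icc (0 : ℝ) 1)ᶜ = 0) (δ : ℝ) {t T : ℕ} (ht : t < T) (ω : Ω) (i : Fin m) :
    armMean D i - (memory (fun s => A s ω) (fun s => X s ω) t).ucb δ i ≤
      radiusExcess δ (played A i) (fun s ω => -noise D X i s ω) T ω := by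
  have h1 := armMean_le_one hD i
  have h0 : (0 : ℝ) ≤ radiusExcess δ (played A i) (fun s ω => -noise D X i s ω) T ω :=
    NNReal.coe_nonneg _
  rw [Memory.ucb, memory_count]
  split_ifs with hN
  · linarith
  · have hpos : 0 < obsCount (played A i) t ω := Nat.pos_of_ne_zero hN
    have hne : (obsCount (played A i) t ω : ℝ) ≠ 0 := by exact_mod_cast hN
    have hz := le_supPosPart ht (ω := ω) (Q := fun t => {ω | 0 < obsCount (played A i) t ω})
      (z := fun t ω => obsSum (played A i) (fun s ω => -noise D X i s ω) t ω /
        obsCount (played A i) t ω - radius δ (obsCount (played A i) t ω)) hpos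
    rw [obsSum_neg, obsSum_noise_eq, ← mul_neg, mul_div_cancel_left₀ _ hne] at hz
    rw [radiusExcess] at h0 ⊢
    rw [sub_le_comm]
    exact le_min (by linarith) (by linarith)

theorem ucb_sub_armMean_le [∀ i, IsProbabilityMeasure (D i)]
    (hD : ∀ i, D i (Set.Icc (0 : ℝ) 1)ᶜ = 0) (δ ε : ℝ) (hε : 0 ≤ ε) {t T : ℕ} (ht : t < T) (ω : Ω)
    (i : Fin m) :
    (memory (fun s => A s ω) (fun s => X s ω) t).ucb δ i - armMean D i ≤
      ε + if obsCount (played A i) t ω = 0 then 1 else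
        radius δ (obsCount (played A i) t ω) +
          constExcess ε (played A i) (noise D X i) T (obsCount (played A i) t ω) ω := by
  have h1 := armMean_nonneg hD i
  rw [Memory.ucb, memory_count]
  split_ifs with hN
  · linarith
  · have hne : (obsCount (played A i) t ω : ℝ) ≠ 0 := by exact_mod_cast hN
    have hz := le_supPosPart ht (ω := ω)
      (Q := fun t' => {ω' | obsCount (played A i) t' ω' = obsCount (played A i) t ω})
      (z := fun t ω => obsSum (played A i) (noise D X i) t ω / obsCount (played A i) t ω - ε) rfl
    rw [obsSum_noise_eq, mul_div_cancel_left₀ _ hne] at hz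
    rw [constExcess]
    have := min_le_left ((memory (fun s => A s ω) (fun s => X s ω) t).mean i +
      radius δ (obsCount (played A i) t ω)) 1
    linarith

open Classical in
theorem sum_comp_obsCount_le {E : ℕ → Set Ω} (ω : Ω) (T : ℕ) {g : ℕ → ℝ} (hg : ∀ n, 0 ≤ g n) :
    ∑ t ∈ (Finset.range T).filter (fun t => ω ∈ E t), g (obsCount E t ω) ≤
      ∑ n ∈ Finset.range T, g n := by
  have himage := Finset.sum_image (s := (Finset.range T).filter fun t => ω ∈ E t)
    (g := fun t => obsCount E t ω) (f := g) fun s hs t ht h =>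
      obsCount_injOn ω (Finset.mem_filter.1 hs).2 (Finset.mem_filter.1 ht).2 h
  rw [← himage]
  refine Finset.sum_le_sum_of_subset_of_nonneg ?_ fun n _ _ => hg n
  intro n hn
  obtain ⟨t, ht, rfl⟩ := Finset.mem_image.1 hn
  have h1 := Finset.mem_range.1 (Finset.mem_filter.1 ht).1
  exact Finset.mem_range.2 ((obsCount_le t ω).trans_lt h1)

theorem sum_ite_radius_add_le {δ : ℝ} (hδ : 0 < δ) {G : ℕ → ℝ≥0} (T : ℕ) :
    ∑ n ∈ Finset.range T, (if n = 0 then 1 else radius δ n + (G n : ℝ)) ≤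
      1 + 6 / √δ + ∑ n ∈ Finset.range T, (G (n + 1) : ℝ) := by
  have hnn : ∀ n : ℕ, (0 : ℝ) ≤ if n = 0 then 1 else radius δ n + (G n : ℝ) := fun n => by
    have := radius_nonneg δ n
    split_ifs <;> positivity
  -- One extra nonnegative term, so that splitting off `n = 0` leaves exactly the counts `n + 1`
  -- with `n < T`.
  calc _ ≤ ∑ n ∈ Finset.range (T + 1), (if n = 0 then 1 else radius δ n + (G n : ℝ)) :=
        Finset.sum_le_sum_of_subset_of_nonneg (Finset.range_mono T.le_succ) fun n _ _ => hnn n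
    _ = 1 + (∑ n ∈ Finset.range T, radius δ (n + 1) + ∑ n ∈ Finset.range T, (G (n + 1) : ℝ)) := by
        rw [Finset.sum_range_succ', ← Finset.sum_add_distrib]
        simp [add_comm]
    _ ≤ _ := by linarith [sum_radius_le hδ T]

variable [mΩ : MeasurableSpace Ω] {P : Measure Ω} {ℱ : Filtration ℕ mΩ}

theorem measurableSet_played (hA : ∀ t B, MeasurableSet[ℱ t] {ω | A t ω = B}) (i : Fin m)
    (t : ℕ) : MeasurableSet[ℱ t] (played A i t) := by
  have : played A i t = ⋃ B ∈ Finset.univ.filter fun B : Finset (Fin m) => i ∈ B,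
      {ω | A t ω = B} := by
    ext ω
    simp [played]
  rw [this]
  exact Finset.measurableSet_biUnion (m := ℱ t) _ fun B _ => hA t B

/-- Hoeffding's lemma: an interval of length `1` gives variance proxy `1 / 4`, hence the exponent `l
^ 2 / 8`. -/
theorem IsEnvironment.isSubgaussianNoise [∀ i, IsProbabilityMeasure (D i)]
    (hD : ∀ i, D i (Set.Icc (0 : ℝ) 1)ᶜ = 0) (hX : IsEnvironment D P ℱ X) (i : Fin m) :
    IsSubgaussianNoise P ℱ (noise D X i) where
  measurable t := by
    have h1 : Measurable fun x : Fin m → ℝ => x i - armMean D i := by fun_prop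
    exact h1.comp (hX.measurable t)
  indep t := by
    refine indep_of_indep_of_le_right (hX.indep_past t).symm ?_
    have h1 : Measurable fun x : Fin m → ℝ => x i - armMean D i := by fun_prop
    exact (h1.comp (comap_measurable (X t))).comap_le
  mgf_le t l := by
    have hXm : Measurable (X t) := (hX.measurable t).mono (ℱ.le _) le_rfl
    have hlaw : P.map (fun ω => X t ω i) = D i := by
      have h1 := Measure.map_map (μ := P) (measurable_pi_apply (X := fun _ => ℝ) i) hXm
      rw [hX.law t, (measurePreserving_eval D i).map_eq] at h1
      exact h1.symm
    have hmeas : Measurable fun x : ℝ =>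
        ENNReal.ofReal (Real.exp (l * (x - armMean D i) - l ^ 2 / 8)) := by fun_prop
    have hmap := lintegral_map (μ := P) hmeas ((measurable_pi_apply i).comp hXm)
    have hsub := hasSubgaussianMGF_of_mem_Icc (μ := D i) (X := fun x => x) aemeasurable_id
      (ae_mem_Icc hD i)
    have hle := hsub.mgf_le l
    have hint := hsub.integrable_exp_mul l
    calc ∫⁻ ω, ENNReal.ofReal (Real.exp (l * noise D X i t ω - l ^ 2 / 8)) ∂P
        = ∫⁻ x, ENNReal.ofReal (Real.exp (l * (x - armMean D i) - l ^ 2 / 8)) ∂(D i) := by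
          rw [← hlaw]
          exact hmap.symm
      _ = ENNReal.ofReal (∫ x, Real.exp (l * (x - armMean D i)) / Real.exp (l ^ 2 / 8) ∂(D i)) := by
          simp_rw [Real.exp_sub]
          exact (ofReal_integral_eq_lintegral_ofReal (hint.div_const _)
            (Filter.Eventually.of_forall fun x => by positivity)).symm
      _ ≤ 1 := by
          rw [← ENNReal.ofReal_one]
          refine ENNReal.ofReal_le_ofReal ?_
          rw [integral_div, div_le_one (Real.exp_pos _)]
          refine hle.trans (Real.exp_le_exp.2 (le_of_eq ?_))
          simp
          ring

/-- The regret is controlled by the excess deviations of the arms. -/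
theorem regret_le [∀ i, IsProbabilityMeasure (D i)] (hD : ∀ i, D i (Set.Icc (0 : ℝ) 1)ᶜ = 0)
    {k : ℕ} {δ ε : ℝ} (hδ : 0 < δ) (hε : 0 ≤ ε) (hA : IsRun k δ ℱ X A) {B : Finset (Fin m)}
    (hB : B ∈ actions m k) (hbest : bestReward k D = reward B (armMean D)) (T : ℕ) (ω : Ω) :
    ∑ t ∈ Finset.range T, (bestReward k D - reward (A t ω) (armMean D)) ≤
      T * ∑ i ∈ B, (radiusExcess δ (played A i) (fun s ω => -noise D X i s ω) T ω : ℝ) +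
      (k * T * ε + m * (1 + 6 / √δ)) +
      ∑ i, ∑ n ∈ Finset.range T, (constExcess ε (played A i) (noise D X i) T (n + 1) ω : ℝ) := by
  classical
  set u : ℕ → Fin m → ℝ := fun t => (memory (fun s => A s ω) (fun s => X s ω) t).ucb δ with hu
  set U : Fin m → ℝ := fun i =>
    (radiusExcess δ (played A i) (fun s ω => -noise D X i s ω) T ω : ℝ) with hU
  set g : Fin m → ℕ → ℝ := fun i n => if n = 0 then 1 else
    radius δ n + constExcess ε (played A i) (noise D X i) T n ω with hgdef
  have hg : ∀ i n, 0 ≤ g i n := fun i n => by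
    have := radius_nonneg δ n
    simp only [hgdef]
    split_ifs <;> positivity
  have hround : ∀ t ∈ Finset.range T, bestReward k D - reward (A t ω) (armMean D) ≤
      ∑ i ∈ B, U i + (k * ε + ∑ i ∈ A t ω, g i (obsCount (played A i) t ω)) := by
    intro t ht
    have ht' := Finset.mem_range.1 ht
    have h1 : reward B (armMean D) - reward B (u t) ≤ ∑ i ∈ B, U i := by
      rw [reward, reward, ← Finset.sum_sub_distrib]
      exact Finset.sum_le_sum fun i _ => armMean_sub_ucb_le hD δ ht' ω i
    have h2 : reward B (u t) ≤ reward (A t ω) (u t) := hA.isMax t ω B hB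
    have h3 : reward (A t ω) (u t) - reward (A t ω) (armMean D) ≤
        ∑ i ∈ A t ω, (ε + g i (obsCount (played A i) t ω)) := by
      rw [reward, reward, ← Finset.sum_sub_distrib]
      exact Finset.sum_le_sum fun i _ => ucb_sub_armMean_le hD δ ε hε ht' ω i
    have h4 : ((A t ω).card : ℝ) * ε ≤ k * ε := by
      gcongr
      exact card_le_of_mem_actions (hA.mem_actions t ω)
    rw [Finset.sum_add_distrib, Finset.sum_const, nsmul_eq_mul] at h3
    rw [hbest]
    linarith
  have hswap : ∑ t ∈ Finset.range T, ∑ i ∈ A t ω, g i (obsCount (played A i) t ω) =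
      ∑ i, ∑ t ∈ (Finset.range T).filter (fun t => ω ∈ played A i t),
        g i (obsCount (played A i) t ω) :=
    Finset.sum_comm' fun t i => by rw [Finset.mem_filter]; simp [played]
  calc _ ≤ ∑ t ∈ Finset.range T,
        (∑ i ∈ B, U i + (k * ε + ∑ i ∈ A t ω, g i (obsCount (played A i) t ω))) :=
        Finset.sum_le_sum hround
    _ = T * ∑ i ∈ B, U i + (k * T * ε + ∑ i, ∑ t ∈ (Finset.range T).filter
        (fun t => ω ∈ played A i t), g i (obsCount (played A i) t ω)) := by
        rw [Finset.sum_add_distrib, Finset.sum_add_distrib, hswap]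
        simp only [Finset.sum_const, Finset.card_range, nsmul_eq_mul]
        ring
    _ ≤ T * ∑ i ∈ B, U i + (k * T * ε + ∑ i : Fin m, (1 + 6 / √δ + ∑ n ∈ Finset.range T,
        (constExcess ε (played A i) (noise D X i) T (n + 1) ω : ℝ))) := by
        gcongr with i _
        exact (sum_comp_obsCount_le ω T (hg i)).trans (sum_ite_radius_add_le hδ T)
    _ = _ := by
        rw [Finset.sum_add_distrib]
        simp only [Finset.sum_const, Finset.card_univ, Fintype.card_fin, nsmul_eq_mul]
        ring

/-- The trivial bound, needed when there are too few plays to learn from (`k * T < m`). -/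
theorem expectedRegret_le_mul [∀ i, IsProbabilityMeasure (D i)] [IsProbabilityMeasure P]
    (hD : ∀ i, D i (Set.Icc (0 : ℝ) 1)ᶜ = 0) {k : ℕ} (hA : ∀ t ω, A t ω ∈ actions m k) (T : ℕ) :
    expectedRegret k D P A T ≤ T * min (k : ℝ) m := by
  have hbound : ∀ ω, ‖∑ t ∈ Finset.range T, (bestReward k D - reward (A t ω) (armMean D))‖ ≤
      T * min (k : ℝ) m := by
    intro ω
    rw [Real.norm_of_nonneg (Finset.sum_nonneg fun t _ =>
      sub_nonneg.2 (reward_le_bestReward D (hA t ω)))]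
    have := Finset.sum_le_card_nsmul (Finset.range T)
      (fun t => bestReward k D - reward (A t ω) (armMean D)) (min (k : ℝ) m) fun t _ => by
        linarith [bestReward_le hD k, reward_armMean_nonneg hD (A t ω)]
    simpa using this
  have := norm_integral_le_of_norm_le_const (μ := P) (Filter.Eventually.of_forall hbound)
  rw [probReal_univ, mul_one] at this
  exact (le_abs_self _).trans this

/-- Integrates `regret_le` with `ε = √δ`. The constants are `13 = 12 + 1` (underestimation and
threshold) and `6.5 = 6 + 1/2` (radii and excess over the threshold); the last `m` pays for first
plays. -/
theorem expectedRegret_le [∀ i, IsProbabilityMeasure (D i)] [IsProbabilityMeasure P]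
    (hD : ∀ i, D i (Set.Icc (0 : ℝ) 1)ᶜ = 0) {k : ℕ} {δ : ℝ} (hδ : 0 < δ) (hδ1 : δ ≤ 1)
    (hX : IsEnvironment D P ℱ X) (hA : IsRun k δ ℱ X A) (T : ℕ) :
    expectedRegret k D P A T ≤ 13 * (k * T * √δ) + 6.5 * (m / √δ) + m := by
  obtain ⟨B, hB, hbest⟩ := Finset.exists_mem_eq_sup' (actions_nonempty m k)
    fun A => reward A (armMean D)
  have hd : 0 < √δ := Real.sqrt_pos.2 hδ
  have hE := fun i => measurableSet_played (ℱ := ℱ) hA.nonanticipating i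
  have hnoise := fun i => hX.isSubgaussianNoise hD i
  set U : Fin m → Ω → ℝ≥0 := fun i =>
    radiusExcess δ (played A i) (fun s ω => -noise D X i s ω) T with hU
  set G : Fin m → ℕ → Ω → ℝ≥0 := fun i n =>
    constExcess (√δ) (played A i) (noise D X i) T (n + 1) with hG
  have hUm : ∀ i, Measurable fun ω => (U i ω : ℝ≥0∞) := fun i =>
    (measurable_radiusExcess (hE i) (hnoise i).neg.measurable δ T).coe_nnreal_ennreal
  have hGm : ∀ i n, Measurable fun ω => (G i n ω : ℝ≥0∞) := fun i n =>
    (measurable_constExcess (hE i) (hnoise i).measurable (√δ) T (n + 1)).coe_nnreal_ennreal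
  obtain ⟨c, hc⟩ : ∃ c : ℝ, c = k * T * √δ + m * (1 + 6 / √δ) := ⟨_, rfl⟩
  have hc0 : 0 ≤ c := by rw [hc]; positivity
  have hnn : ∀ ω, 0 ≤ ∑ t ∈ Finset.range T, (bestReward k D - reward (A t ω) (armMean D)) :=
    fun ω => Finset.sum_nonneg fun t _ =>
      sub_nonneg.2 (reward_le_bestReward D (hA.mem_actions t ω))
  have hBk : (B.card : ℝ) ≤ k := by exact_mod_cast card_le_of_mem_actions hB
  -- Bounding the lower integral of the norm avoids any measurability argument for the regret
  -- itself.
  have hlint : ∫⁻ ω, ENNReal.ofReal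
      ‖∑ t ∈ Finset.range T, (bestReward k D - reward (A t ω) (armMean D))‖ ∂P ≤
      ENNReal.ofReal (T * (k * (12 * √δ)) + c + m * (1 / (2 * √δ))) := by
    calc _ ≤ ∫⁻ ω, (((T : ℝ≥0∞) * ∑ i ∈ B, (U i ω : ℝ≥0∞) + ENNReal.ofReal c) +
          ∑ i, ∑ n ∈ Finset.range T, (G i n ω : ℝ≥0∞)) ∂P := by
          refine lintegral_mono fun ω => ?_
          rw [Real.norm_of_nonneg (hnn ω)]
          refine (ENNReal.ofReal_le_ofReal
            (regret_le hD hδ hd.le hA hB hbest T ω)).trans (le_of_eq ?_)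
          rw [← hc, ENNReal.ofReal_add (by positivity) (by positivity),
            ENNReal.ofReal_add (by positivity) hc0, ENNReal.ofReal_mul (by positivity),
            ENNReal.ofReal_natCast, ENNReal.ofReal_sum_of_nonneg fun i _ => by positivity,
            ENNReal.ofReal_sum_of_nonneg fun i _ => by positivity]
          simp_rw [ENNReal.ofReal_sum_of_nonneg fun n _ => NNReal.coe_nonneg _,
            ENNReal.ofReal_coe_nnreal]
          rfl
      _ = (T : ℝ≥0∞) * ∑ i ∈ B, ∫⁻ ω, U i ω ∂P + ENNReal.ofReal c +
          ∑ i, ∑ n ∈ Finset.range T, ∫⁻ ω, G i n ω ∂P := by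
          rw [lintegral_add_left (by fun_prop), lintegral_add_left (by fun_prop),
            lintegral_const_mul _ (by fun_prop), lintegral_finsetSum _ fun i _ => hUm i,
            lintegral_finsetSum _ fun i _ => by fun_prop]
          simp_rw [lintegral_finsetSum (Finset.range T) fun n _ => hGm _ n]
          simp
      _ ≤ (T : ℝ≥0∞) * ∑ i ∈ B, ENNReal.ofReal (12 * √δ) + ENNReal.ofReal c +
          ∑ i : Fin m, ENNReal.ofReal (1 / (2 * √δ)) := by
          gcongr with i _ i _
          · exact lintegral_radiusExcess_le (hnoise i).neg (hE i) hδ hδ1 T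
          · exact sum_lintegral_constExcess_le (hnoise i) (hE i) hd T
      _ = ENNReal.ofReal (T * (B.card * (12 * √δ)) + c + m * (1 / (2 * √δ))) := by
          rw [ENNReal.ofReal_add (by positivity) (by positivity),
            ENNReal.ofReal_add (by positivity) hc0, ENNReal.ofReal_mul (by positivity),
            ENNReal.ofReal_mul (by positivity), ENNReal.ofReal_mul (p := (m : ℝ)) (by positivity)]
          simp
      _ ≤ _ := by gcongr
  have h := (le_abs_self _).trans (norm_integral_le_lintegral_norm (μ := P)
    fun ω => ∑ t ∈ Finset.range T, (bestReward k D - reward (A t ω) (armMean D)))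
  refine (h.trans (ENNReal.toReal_le_of_le_ofReal (by positivity) hlint)).trans (le_of_eq ?_)
  rw [hc]
  field_simp
  ring

end Run

end CMOSS

/-! ### Choice of the parameter and conclusion -/

theorem theorem1 :
    ∃ C : ℝ, 0 < C ∧
      ∀ (m k T : ℕ), 1 ≤ k →
      ∀ (D : Fin m → Measure ℝ) [∀ i, IsProbabilityMeasure (D i)],
      (∀ i, D i (Set.Icc (0 : ℝ) 1)ᶜ = 0) →
      ∀ {Ω : Type*} [mΩ : MeasurableSpace Ω] (P : Measure Ω) [IsProbabilityMeasure P]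
        (ℱ : Filtration ℕ mΩ) (X : ℕ → Ω → Fin m → ℝ) (A : ℕ → Ω → Finset (Fin m)),
      CMOSS.IsEnvironment D P ℱ X →
      CMOSS.IsRun k ((m : ℝ) / ((k : ℝ) * (T : ℝ))) ℱ X A →
      CMOSS.expectedRegret k D P A T ≤
        C * (max 1 (Real.logb 2 (k : ℝ))) ^ 2 * √((k : ℝ) * (m : ℝ) * (T : ℝ)) := by
  -- In the main case the three terms give `13 + 6.5 + 1 = 20.5` multiples of `R`.
  refine ⟨21, by norm_num, ?_⟩
  intro m k T hk D _ hD Ω mΩ P _ ℱ X A hX hA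
  set R := √((k : ℝ) * (m : ℝ) * (T : ℝ)) with hR
  have hR0 : 0 ≤ R := Real.sqrt_nonneg _
  have hlog : (1 : ℝ) ≤ (max 1 (Real.logb 2 (k : ℝ))) ^ 2 := one_le_pow₀ (le_max_left _ _)
  suffices h : CMOSS.expectedRegret k D P A T ≤ 21 * R by nlinarith
  have htriv := CMOSS.expectedRegret_le_mul (P := P) hD hA.mem_actions T
  have hk0 : (0 : ℝ) < k := by exact_mod_cast hk
  rcases Nat.eq_zero_or_pos m with hm | hm
  · have : (T : ℝ) * min (k : ℝ) m = 0 := by simp [hm]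
    linarith
  -- The deviation bounds require `δ ≤ 1`, that is `m ≤ k * T`. The other case includes `T = 0`;
  -- there the trivial bound `k * T` is already at most `R`.
  rcases lt_or_ge (k * T) m with hlt | hge
  · have h1 : (k : ℝ) * T ≤ m := by exact_mod_cast hlt.le
    have h2 : (T : ℝ) * min (k : ℝ) m ≤ k * T := by
      rw [mul_comm]
      gcongr
      exact min_le_left _ _
    have h3 : (k : ℝ) * T ≤ R := by
      refine Real.le_sqrt_of_sq_le ?_
      have : (k : ℝ) * T * (k * T) ≤ k * T * m := by gcongr
      linarith
    linarith
  · have hm0 : (0 : ℝ) < m := by exact_mod_cast hm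
    have hT : 0 < T := Nat.pos_of_ne_zero fun h => by simp [h] at hge; omega
    have hT0 : (0 : ℝ) < T := by exact_mod_cast hT
    have hge' : (m : ℝ) ≤ k * T := by exact_mod_cast hge
    have hmain := CMOSS.expectedRegret_le hD (by positivity)
      ((div_le_one (by positivity)).2 hge') hX hA T
    have hR2 : R ^ 2 = k * m * T := Real.sq_sqrt (by positivity)
    have hRpos : 0 < R := Real.sqrt_pos.2 (by positivity)
    have hsqrt : √((m : ℝ) / (k * T)) = R / (k * T) := by
      rw [Real.sqrt_eq_iff_eq_sq (by positivity) (by positivity), div_pow, hR2]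
      field_simp
    have h1 : (k : ℝ) * T * (R / (k * T)) = R := by field_simp
    have h2 : (m : ℝ) / (R / (k * T)) = R := by
      rw [div_div_eq_mul_div, div_eq_iff hRpos.ne', ← sq, hR2]
      ring
    have h3 : (m : ℝ) ≤ R := by
      refine Real.le_sqrt_of_sq_le ?_
      have : (m : ℝ) * m ≤ m * (k * T) := by gcongr
      linarith
    rw [hsqrt, h1, h2] at hmain
    linarith
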